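/- Let $\mathcal A$ be the CAR $C^*$-algebra over $\mathbb Z$, with annihilation operators $a_i$ ($i\in\mathbb Z$) satisfying $\{a_i^*,a_j\}=\delta_{i,j}1$ and $\{a_i,a_j\}=\{a_i^*,a_j^*\}=0$. Let $\mathcal A_\circ=\bigcup_{I}\mathcal A(I)$ be its local algebra, where $I$ runs over the finite subsets of $\mathbb Z$ and $\mathcal A(I)$ is the $*$-algebra generated by $\{a_i : i\in I\}$. Let $\gamma$ be the grading automorphism, $\gamma(a_i)=-a_i$, and let $[\,\cdot\,,\cdot\,]_\gamma$ be the graded commutator: the anticommutator of two odd elements, and the commutator if one of the two is even. Put $q_i=a_{2i+1}a_{2i}^*a_{2i-1}$ and, for $A\in\mathcal A_\circ$, $$\delta(A)=\sum_{i\in\mathbb Z}[q_i,A]_\gamma,\qquad \delta^*(A)=\sum_{i\in\mathbb Z}[q_i^*,A]_\gamma,\qquad d(A)=\sum_{i,j\in\mathbb Z}\bigl[\{q_i,q_j^*\},A\bigr]$$ (each sum has only finitely many nonzero terms). Let $(\alpha_t)_{t\in\mathbb R}$ be the Nicolai time evolution, that is, the strongly continuous one-parameter group of $*$-automorphisms of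 $\mathcal A$ with pre-generator $d$: the closure of $i\,d$ on $\mathcal A_\circ$ is the infinitesimal generator $X\mapsto\frac{d}{dt}\big|_{t=0}\alpha_t(X)$ of $(\alpha_t)$. If $B\in\mathcal A_\circ$ satisfies $\delta(B)=0=\delta^*(B)$, then $\alpha_t(B)=B$ for all $t\in\mathbb R$. -/

import Mathlib

noncomputable section

namespace Nicolai

/-! ### Fock space over `ℤ` and the canonical anticommutation relations -/

/-- The antisymmetric Fock space of spinless fermions on the lattice `ℤ`, in the occupation-number
basis: `ℓ²` over the finite sets `S` of occupied sites. -/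
abbrev Fock : Type := lp (fun _ : Finset ℤ => ℂ) 2

/-- Bounded operators on Fock space, with adjoint as `star`. -/
abbrev Op : Type := Fock →L[ℂ] Fock

/-- Flipping the occupation of site `i`. -/
def toggle (i : ℤ) : Equiv.Perm (Finset ℤ) :=
  Function.Involutive.toPerm (fun S => symmDiff S {i}) (fun S => by simp)

theorem toggle_of_mem {i : ℤ} {S : Finset ℤ} (h : i ∈ S) : toggle i S = S.erase i := by
  ext j
  change j ∈ symmDiff S {i} ↔ _
  simp only [Finset.mem_symmDiff, Finset.mem_singleton, Finset.mem_erase]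
  grind

theorem toggle_of_notMem {i : ℤ} {S : Finset ℤ} (h : i ∉ S) : toggle i S = insert i S := by
  ext j
  change j ∈ symmDiff S {i} ↔ _
  simp only [Finset.mem_symmDiff, Finset.mem_singleton, Finset.mem_insert]
  grind

theorem summable_sq (f : Fock) : Summable fun S => ‖f S‖ ^ 2 := by
  have h := (lp.memℓp f).summable (by norm_num)
  simpa using h

theorem norm_sq_eq (f : Fock) : ‖f‖ ^ 2 = ∑' S, ‖f S‖ ^ 2 := by
  have h := lp.norm_rpow_eq_tsum (p := 2) (by norm_num) f
  simpa using h

theorem weighted_le (e : Equiv.Perm (Finset ℤ)) (w : Finset ℤ → ℂ) (hw : ∀ S, ‖w S‖ ≤ 1)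
    (f : Fock) (S : Finset ℤ) : ‖w S * f (e S)‖ ^ 2 ≤ ‖f (e S)‖ ^ 2 := by
  rw [norm_mul]
  gcongr
  exact mul_le_of_le_one_left (norm_nonneg _) (hw S)

/-- The bounded operator `(T f)(S) = w(S) f(e(S))` for a permutation `e` of the configurations and
a weight `w` bounded by `1`. -/
def weighted (e : Equiv.Perm (Finset ℤ)) (w : Finset ℤ → ℂ) (hw : ∀ S, ‖w S‖ ≤ 1) : Op :=
  LinearMap.mkContinuous
    { toFun := fun f => ⟨fun S => w S * f (e S), by
        refine memℓp_gen ?_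
        have h := Summable.of_nonneg_of_le (fun S => by positivity) (weighted_le e w hw f)
          (e.summable_iff.mpr (summable_sq f))
        simpa using h⟩
      map_add' := fun f g => by
        ext S
        exact mul_add _ _ _
      map_smul' := fun c f => by
        ext S
        exact mul_left_comm _ _ _ }
    1 (fun f => by
      have hs := e.summable_iff.mpr (summable_sq f)
      rw [one_mul]
      refine le_of_sq_le_sq ?_ (norm_nonneg f)
      rw [norm_sq_eq, norm_sq_eq, ← e.tsum_eq (fun S => ‖f S‖ ^ 2)]
      exact Summable.tsum_le_tsum (weighted_le e w hw f)
        (Summable.of_nonneg_of_le (fun S => by positivity) (weighted_le e w hw f) hs) hs)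

/-- The amplitude of `f` at the configuration `S`. -/
def coord (f : Fock) (S : Finset ℤ) : ℂ := f S

theorem op_ext {X Y : Op} (h : ∀ f S, coord (X f) S = coord (Y f) S) : X = Y := by
  ext f S
  exact h f S

theorem coord_add (X Y : Op) (f : Fock) (S : Finset ℤ) :
    coord ((X + Y) f) S = coord (X f) S + coord (Y f) S := rfl

theorem coord_neg (X : Op) (f : Fock) (S : Finset ℤ) : coord ((-X) f) S = -coord (X f) S := rfl

theorem coord_mul (X Y : Op) (f : Fock) (S : Finset ℤ) :
    coord ((X * Y) f) S = coord (X (Y f)) S := rfl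

theorem coord_one (f : Fock) (S : Finset ℤ) : coord ((1 : Op) f) S = coord f S := rfl

theorem coord_zero (f : Fock) (S : Finset ℤ) : coord ((0 : Op) f) S = 0 := rfl

theorem weighted_apply (e : Equiv.Perm (Finset ℤ)) (w : Finset ℤ → ℂ) (hw : ∀ S, ‖w S‖ ≤ 1)
    (f : Fock) (S : Finset ℤ) : coord (weighted e w hw f) S = w S * coord f (e S) := rfl

/-- The Jordan–Wigner sign `(-1)^{#{j ∈ S : j < i}}`. -/
def jwSign (i : ℤ) (S : Finset ℤ) : ℂ := (-1) ^ (S.filter (· < i)).card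

/-- The annihilation operator `a_i` of a fermion at site `i`. -/
def a (i : ℤ) : Op :=
  weighted (toggle i) (fun S => if i ∈ S then 0 else jwSign i S)
    (fun S => by split_ifs <;> simp [jwSign])

theorem a_apply (i : ℤ) (f : Fock) (S : Finset ℤ) :
    coord (a i f) S = if i ∈ S then 0 else jwSign i S * coord f (insert i S) := by
  rw [a, weighted_apply]
  split_ifs with h
  · simp
  · rw [toggle_of_notMem h]

theorem star_weighted_apply (e : Equiv.Perm (Finset ℤ)) (w : Finset ℤ → ℂ) (hw : ∀ S, ‖w S‖ ≤ 1)
    (f : Fock) (S : Finset ℤ) :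
    coord (star (weighted e w hw) f) S = star (w (e.symm S)) * coord f (e.symm S) := by
  have key : star (weighted e w hw)
      = weighted e.symm (fun S => star (w (e.symm S))) (fun S => by simpa using hw _) := by
    rw [ContinuousLinearMap.star_eq_adjoint]
    symm
    rw [ContinuousLinearMap.eq_adjoint_iff]
    intro f g
    rw [lp.inner_eq_tsum, lp.inner_eq_tsum, ← e.tsum_eq]
    refine tsum_congr fun S => ?_
    change inner ℂ (coord (weighted e.symm _ _ f) (e S)) (coord g (e S))
      = inner ℂ (coord f S) (coord (weighted e w hw g) S)
    simp only [weighted_apply, Equiv.symm_apply_apply, RCLike.inner_apply, map_mul,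
      RCLike.star_def, RCLike.conj_conj]
    ring
  rw [key, weighted_apply]

theorem star_a_apply (i : ℤ) (f : Fock) (S : Finset ℤ) :
    coord (star (a i) f) S = if i ∈ S then jwSign i S * coord f (S.erase i) else 0 := by
  have hs : (toggle i).symm S = toggle i S := rfl
  rw [a, star_weighted_apply, hs]
  split_ifs with h1 h2 h2
  · rw [toggle_of_mem h2] at h1
    simp at h1
  · simp
  · rw [toggle_of_mem h2]
    have : (S.erase i).filter (· < i) = S.filter (· < i) := by
      ext j
      simp only [Finset.mem_filter, Finset.mem_erase]
      grind
    simp [jwSign, this]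
  · rw [toggle_of_notMem h2] at h1
    simp at h1

theorem jwSign_sq (i : ℤ) (S : Finset ℤ) : jwSign i S * jwSign i S = 1 := by
  rw [jwSign, ← mul_pow]
  simp

theorem jwSign_insert {i j : ℤ} {S : Finset ℤ} (h : j ∉ S) :
    jwSign i (insert j S) = if j < i then -jwSign i S else jwSign i S := by
  unfold jwSign
  rw [Finset.filter_insert]
  split_ifs with hj
  · rw [Finset.card_insert_of_notMem (by simp [h]), pow_succ]
    ring
  · rfl

theorem jwSign_erase {i j : ℤ} {S : Finset ℤ} (h : j ∈ S) :
    jwSign i (S.erase j) = if j < i then -jwSign i S else jwSign i S := by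
  have h2 := jwSign_insert (i := i) (Finset.notMem_erase j S)
  rw [Finset.insert_erase h] at h2
  split_ifs at h2 ⊢ with hj
  · rw [h2]; ring
  · exact h2.symm

theorem anticomm_a_a (i j : ℤ) : a i * a j + a j * a i = 0 := by
  refine op_ext fun f S => ?_
  simp only [coord_add, coord_mul, coord_zero, a_apply, Finset.mem_insert]
  by_cases hij : i = j
  · subst hij
    simp
  by_cases hi : i ∈ S
  · simp [hi]
  by_cases hj : j ∈ S
  · simp [hj]
  have hji : ¬ j = i := fun h => hij h.symm
  simp only [hi, hj, hij, hji, if_false, or_self, jwSign_insert hi, jwSign_insert hj,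
    Finset.insert_comm i j]
  rcases lt_or_gt_of_ne hij with h | h
  · simp only [h, if_true, h.le.not_gt, if_false]
    ring
  · simp only [h, if_true, h.le.not_gt, if_false]
    ring

theorem anticomm_star_star (i j : ℤ) :
    star (a i) * star (a j) + star (a j) * star (a i) = 0 := by
  rw [← star_mul, ← star_mul, ← star_add, anticomm_a_a, star_zero]

theorem anticomm_star_a (i j : ℤ) :
    star (a i) * a j + a j * star (a i) = if i = j then 1 else 0 := by
  refine op_ext fun f S => ?_
  have hR : coord ((if i = j then (1 : Op) else 0) f) S = if i = j then coord f S else 0 := by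
    split_ifs <;> rfl
  rw [hR]
  simp only [coord_add, coord_mul, a_apply, star_a_apply, Finset.mem_insert, Finset.mem_erase]
  by_cases hij : i = j
  · subst hij
    by_cases hi : i ∈ S
    · simp [hi, jwSign_erase hi, Finset.insert_erase hi, ← mul_assoc, jwSign_sq]
    · simp [hi, jwSign_insert hi, ← mul_assoc, jwSign_sq]
  have hji : ¬ j = i := fun h => hij h.symm
  by_cases hi : i ∈ S
  · by_cases hj : j ∈ S
    · simp [hj, hij, hji]
    · have he : (insert j S).erase i = insert j (S.erase i) := by
        ext k; simp only [Finset.mem_insert, Finset.mem_erase]; grind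
      simp only [hi, hj, hij, if_true, if_false, and_false, or_true, he,
        jwSign_erase hi, jwSign_insert hj]
      rcases lt_or_gt_of_ne hij with h | h
      · simp only [h, if_true, h.le.not_gt, if_false]
        ring
      · simp only [h, if_true, h.le.not_gt, if_false]
        ring
  · simp [hi, hij]

/-! ### Local algebras, the CAR algebra and its grading -/

/-- `𝒜(I)`: the `*`-algebra generated by `a_i, a_i*`, `i ∈ I`, for a finite region `I`. -/
def regionAlgebra (I : Finset ℤ) : StarSubalgebra ℂ Op := StarAlgebra.adjoin ℂ (a '' (I : Set ℤ))

theorem regionAlgebra_mono {I J : Finset ℤ} (h : I ⊆ J) : regionAlgebra I ≤ regionAlgebra J :=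
  StarAlgebra.adjoin_mono (Set.image_mono (by exact_mod_cast h))

theorem a_mem_region {i : ℤ} {I : Finset ℤ} (h : i ∈ I) : a i ∈ regionAlgebra I :=
  StarAlgebra.subset_adjoin ℂ _ ⟨i, by exact_mod_cast h, rfl⟩

/-- The local algebra `𝒜_∘ = ⋃_I 𝒜(I)`, the union over all finite regions. -/
def localAlgebra : StarSubalgebra ℂ Op where
  carrier := {X | ∃ I : Finset ℤ, X ∈ regionAlgebra I}
  mul_mem' := by
    rintro X Y ⟨I, hX⟩ ⟨J, hY⟩
    exact ⟨I ∪ J, mul_mem (regionAlgebra_mono Finset.subset_union_left hX)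
      (regionAlgebra_mono Finset.subset_union_right hY)⟩
  add_mem' := by
    rintro X Y ⟨I, hX⟩ ⟨J, hY⟩
    exact ⟨I ∪ J, add_mem (regionAlgebra_mono Finset.subset_union_left hX)
      (regionAlgebra_mono Finset.subset_union_right hY)⟩
  algebraMap_mem' := fun c => ⟨∅, algebraMap_mem _ c⟩
  star_mem' := by
    rintro X ⟨I, hX⟩
    exact ⟨I, star_mem hX⟩

theorem mem_localAlgebra {X : Op} : X ∈ localAlgebra ↔ ∃ I : Finset ℤ, X ∈ regionAlgebra I :=
  Iff.rfl

theorem a_mem_local (i : ℤ) : a i ∈ localAlgebra := ⟨{i}, a_mem_region (by simp)⟩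

/-- The CAR algebra `𝒜` over `ℤ`: the norm closure of the local algebra. -/
def CAR : StarSubalgebra ℂ Op := localAlgebra.topologicalClosure

/-- `𝒜` is a `C*`-algebra. -/
instance : CompleteSpace CAR :=
  (StarSubalgebra.isClosed_topologicalClosure localAlgebra).completeSpace_coe

/-- The inclusion `𝒜_∘ ⊆ 𝒜`. -/
def toCAR : localAlgebra →⋆ₐ[ℂ] CAR :=
  StarSubalgebra.inclusion (StarSubalgebra.le_topologicalClosure localAlgebra)

/-- The fermion parity operator `(-1)^F`, where `F` is the total fermion number. -/
def parity : Op := weighted (Equiv.refl _) (fun S => (-1) ^ S.card) (fun S => by simp)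

theorem parity_apply (f : Fock) (S : Finset ℤ) :
    coord (parity f) S = (-1) ^ S.card * coord f S := rfl

theorem parity_mul_parity : parity * parity = 1 := by
  refine op_ext fun f S => ?_
  simp only [coord_mul, parity_apply, coord_one, ← mul_assoc, ← mul_pow]
  simp

theorem star_parity : star parity = parity := by
  refine op_ext fun f S => ?_
  rw [parity, star_weighted_apply, weighted_apply]
  simp

/-- The grading `γ = Ad (-1)^F`. -/
def grading (X : Op) : Op := parity * X * parity

theorem grading_add (X Y : Op) : grading (X + Y) = grading X + grading Y := by
  simp only [grading, mul_add, add_mul]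

theorem grading_mul (X Y : Op) : grading (X * Y) = grading X * grading Y := by
  simp only [grading, mul_assoc]
  rw [← mul_assoc parity parity, parity_mul_parity, one_mul]

theorem grading_star (X : Op) : grading (star X) = star (grading X) := by
  simp only [grading, star_mul, star_parity, mul_assoc]

theorem grading_algebraMap (c : ℂ) : grading (algebraMap ℂ Op c) = algebraMap ℂ Op c := by
  rw [grading, ← Algebra.commutes, mul_assoc, parity_mul_parity, mul_one]

theorem grading_grading (X : Op) : grading (grading X) = X := by
  simp only [grading, mul_assoc, parity_mul_parity, mul_one]
  rw [← mul_assoc, parity_mul_parity, one_mul]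

theorem grading_a (i : ℤ) : grading (a i) = -a i := by
  refine op_ext fun f S => ?_
  simp only [grading, coord_mul, parity_apply, a_apply, coord_neg]
  split_ifs with h
  · simp
  · rw [Finset.card_insert_of_notMem h, pow_succ]
    have : ((-1 : ℂ) ^ S.card) * (-1) ^ S.card = 1 := by rw [← mul_pow]; simp
    linear_combination (-(jwSign i S * coord f (insert i S))) * this

theorem grading_star_a (i : ℤ) : grading (star (a i)) = -star (a i) := by
  rw [grading_star, grading_a, star_neg]

theorem grading_mem_region {I : Finset ℤ} {X : Op} (hX : X ∈ regionAlgebra I) :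
    grading X ∈ regionAlgebra I := by
  induction hX using StarAlgebra.adjoin_induction with
  | mem x h =>
    obtain ⟨i, hi, rfl⟩ := h
    rw [grading_a]
    exact neg_mem (a_mem_region (by exact_mod_cast hi))
  | algebraMap r => rw [grading_algebraMap]; exact algebraMap_mem _ r
  | add x y _ _ h1 h2 => rw [grading_add]; exact add_mem h1 h2
  | mul x y _ _ h1 h2 => rw [grading_mul]; exact mul_mem h1 h2
  | star x _ h => rw [grading_star]; exact star_mem h

theorem grading_mem_local {X : Op} (hX : X ∈ localAlgebra) : grading X ∈ localAlgebra :=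
  hX.imp fun _ h => grading_mem_region h

/-- The even part `X₊` of `X`. -/
def evenPart (X : Op) : Op := (1 / 2 : ℂ) • (X + grading X)

/-- The odd part `X₋` of `X`. -/
def oddPart (X : Op) : Op := (1 / 2 : ℂ) • (X - grading X)

/-- The graded commutator
`[F, G]_γ = [F₊, G] + [F₋, G₊] + {F₋, G₋}`. -/
def gradedComm (F G : Op) : Op :=
  (evenPart F * G - G * evenPart F) +
  (oddPart F * evenPart G - evenPart G * oddPart F) +
  (oddPart F * oddPart G + oddPart G * oddPart F)

theorem gradedComm_mem_local {F G : Op} (hF : F ∈ localAlgebra) (hG : G ∈ localAlgebra) :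
    gradedComm F G ∈ localAlgebra := by
  have he : ∀ X ∈ localAlgebra, evenPart X ∈ localAlgebra := fun X hX =>
    localAlgebra.smul_mem (add_mem hX (grading_mem_local hX)) _
  have ho : ∀ X ∈ localAlgebra, oddPart X ∈ localAlgebra := fun X hX =>
    localAlgebra.smul_mem (sub_mem hX (grading_mem_local hX)) _
  exact add_mem (add_mem (sub_mem (mul_mem (he F hF) hG) (mul_mem hG (he F hF)))
    (sub_mem (mul_mem (ho F hF) (he G hG)) (mul_mem (he G hG) (ho F hF))))
    (add_mem (mul_mem (ho F hF) (ho G hG)) (mul_mem (ho G hG) (ho F hF)))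

/-! ### The Nicolai model -/

/-- The local supercharge `q_i = a_{2i+1} a_{2i}* a_{2i-1}`; formally `Q_Nic = ∑_i q_i`. -/
def q (i : ℤ) : Op := a (2 * i + 1) * star (a (2 * i)) * a (2 * i - 1)

/-- The sites `{2i-1, 2i, 2i+1}`. -/
def qSites (i : ℤ) : Finset ℤ := {2 * i - 1, 2 * i, 2 * i + 1}

theorem q_mem_region (i : ℤ) : q i ∈ regionAlgebra (qSites i) :=
  mul_mem (mul_mem (a_mem_region (by simp [qSites])) (star_mem (a_mem_region (by simp [qSites]))))
    (a_mem_region (by simp [qSites]))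

theorem q_mem_local (i : ℤ) : q i ∈ localAlgebra := ⟨_, q_mem_region i⟩

theorem grading_q (i : ℤ) : grading (q i) = -q i := by
  simp only [q, grading_mul, grading_a, grading_star_a]
  noncomm_ring

theorem grading_star_q (i : ℤ) : grading (star (q i)) = -star (q i) := by
  rw [grading_star, grading_q, star_neg]

/-- `{q_i, q_j*}`; formally `H_Nic = {Q_Nic, Q_Nic*} = ∑_{i,j} {q_i, q_j*}`. -/
def hTerm (i j : ℤ) : Op := q i * star (q j) + star (q j) * q i

theorem hTerm_mem_local (i j : ℤ) : hTerm i j ∈ localAlgebra :=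
  add_mem (mul_mem (q_mem_local i) (star_mem (q_mem_local j)))
    (mul_mem (star_mem (q_mem_local j)) (q_mem_local i))

/-! #### The formal sums below have only finitely many nonzero terms on local elements -/

theorem gradedComm_of_odd {F : Op} (hF : grading F = -F) (G : Op) :
    gradedComm F G = F * G - grading G * F := by
  have he : evenPart F = 0 := by simp [evenPart, hF]
  have ho : oddPart F = F := by
    rw [oddPart, hF, sub_neg_eq_add, ← two_smul ℂ F, smul_smul]; norm_num
  rw [gradedComm, he, ho]
  simp only [evenPart, oddPart, zero_mul, mul_zero, mul_smul_comm, smul_mul_assoc, mul_add, mul_sub, add_mul, sub_mul]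
  module

/-- `γ`-locality for the generators. -/
theorem generator_locality {j : ℤ} {I : Finset ℤ} (hj : j ∉ I) {X : Op}
    (hX : X ∈ regionAlgebra I) :
    a j * X = grading X * a j ∧ star (a j) * X = grading X * star (a j) := by
  induction hX using StarAlgebra.adjoin_induction with
  | mem x hx =>
    obtain ⟨i, hi, rfl⟩ := hx
    have hij : ¬ i = j := fun e => hj (by exact_mod_cast e ▸ hi)
    have h1 := anticomm_a_a j i
    have h2 := anticomm_star_a j i
    rw [if_neg fun e => hij e.symm] at h2
    rw [grading_a, neg_mul, neg_mul]
    exact ⟨eq_neg_of_add_eq_zero_left h1, eq_neg_of_add_eq_zero_left h2⟩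
  | algebraMap r =>
    rw [grading_algebraMap]
    exact ⟨(Algebra.commutes r _).symm, (Algebra.commutes r _).symm⟩
  | add x y _ _ h1 h2 =>
    simp only [grading_add, mul_add, add_mul, h1.1, h1.2, h2.1, h2.2, and_self]
  | mul x y _ _ h1 h2 =>
    rw [grading_mul]
    constructor
    · rw [← mul_assoc, h1.1, mul_assoc, h2.1, mul_assoc]
    · rw [← mul_assoc, h1.2, mul_assoc, h2.2, mul_assoc]
  | star x _ hx =>
    have aux : ∀ b : Op, grading b = -b → b * x = grading x * b →
        star b * star x = grading (star x) * star b := by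
      intro b hb h
      have h' := congrArg grading h
      rw [grading_mul, grading_mul, grading_grading, hb] at h'
      have h'' : x * b = b * grading x := by
        simpa using h'.symm
      have := congrArg star h''
      rwa [star_mul, star_mul, ← grading_star] at this
    refine ⟨?_, ?_⟩
    · simpa using aux (star (a j)) (grading_star_a j) hx.2
    · exact aux (a j) (grading_a j) hx.1

theorem q_locality {i : ℤ} {I : Finset ℤ} (hi : Disjoint (qSites i) I) {X : Op}
    (hX : X ∈ regionAlgebra I) :
    q i * X = grading X * q i ∧ star (q i) * X = grading X * star (q i) := by
  have hm : ∀ k ∈ qSites i, k ∉ I := fun k hk => Finset.disjoint_left.mp hi hk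
  have n1 := hm (2 * i - 1) (by simp [qSites])
  have n2 := hm (2 * i) (by simp [qSites])
  have n3 := hm (2 * i + 1) (by simp [qSites])
  have hgX := grading_mem_region hX
  constructor
  · simp only [q, mul_assoc]
    rw [(generator_locality n1 hX).1, ← mul_assoc (star _), (generator_locality n2 hgX).2,
      grading_grading, mul_assoc, ← mul_assoc, (generator_locality n3 hX).1, mul_assoc]
  · simp only [q, mul_assoc, star_mul, star_star]
    rw [(generator_locality n3 hX).2, ← mul_assoc (a _), (generator_locality n2 hgX).1,
      grading_grading, mul_assoc, ← mul_assoc, (generator_locality n1 hX).2, mul_assoc]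

theorem finite_not_disjoint (I : Finset ℤ) : {i : ℤ | ¬ Disjoint (qSites i) I}.Finite := by
  have hsub : {i : ℤ | ¬ Disjoint (qSites i) I} ⊆
      ⋃ k ∈ I, {i : ℤ | k ∈ qSites i} := by
    intro i hi
    obtain ⟨k, hk, hkI⟩ := Finset.not_disjoint_iff.mp hi
    exact Set.mem_biUnion hkI hk
  refine Set.Finite.subset (I.finite_toSet.biUnion fun k _ => ?_) hsub
  refine Set.Finite.subset (Set.finite_Icc (-|k| - 1) (|k| + 1)) ?_
  intro i hi
  simp only [qSites, Set.mem_ofPred_eq, Finset.mem_insert, Finset.mem_singleton] at hi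
  have := neg_abs_le k
  have := le_abs_self k
  constructor <;> grind

theorem finite_support_q {X : Op} (hX : X ∈ localAlgebra) :
    (Function.support fun i => gradedComm (q i) X).Finite := by
  obtain ⟨I, hX⟩ := hX
  refine (finite_not_disjoint I).subset fun i hi hd => hi ?_
  simp only [gradedComm_of_odd (grading_q i), (q_locality hd hX).1, sub_self]

theorem finite_support_star_q {X : Op} (hX : X ∈ localAlgebra) :
    (Function.support fun i => gradedComm (star (q i)) X).Finite := by
  obtain ⟨I, hX⟩ := hX
  refine (finite_not_disjoint I).subset fun i hi hd => hi ?_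
  simp only [gradedComm_of_odd (grading_star_q i), (q_locality hd hX).2, sub_self]

theorem finite_support_hTerm {X : Op} (hX : X ∈ localAlgebra) :
    (Function.support fun p : ℤ × ℤ => hTerm p.1 p.2 * X - X * hTerm p.1 p.2).Finite := by
  obtain ⟨I, hX⟩ := hX
  have hfin := ((finite_not_disjoint I).biUnion fun i _ =>
    (finite_not_disjoint (qSites i)))
  have hfin2 := (finite_not_disjoint I).union hfin
  refine (hfin2.prod hfin2).subset ?_
  rintro ⟨i, j⟩ hp
  by_contra hn
  refine hp ?_
  have hzero : Disjoint (qSites i) (qSites j) → hTerm i j = 0 := fun hd => by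
    rw [hTerm, (q_locality hd (star_mem (q_mem_region j))).1, grading_star_q, neg_mul,
      neg_add_cancel]
  have hcomm : Disjoint (qSites i) I → Disjoint (qSites j) I →
      hTerm i j * X = X * hTerm i j := fun h1 h2 => by
    have hgX := grading_mem_region hX
    rw [hTerm, add_mul, mul_add, mul_assoc, mul_assoc, (q_locality h2 hX).2, (q_locality h1 hX).1,
      ← mul_assoc, ← mul_assoc, (q_locality h1 hgX).1, (q_locality h2 hgX).2, grading_grading,
      mul_assoc, mul_assoc]
  simp only
  by_cases hij : Disjoint (qSites i) (qSites j)
  · simp [hzero hij]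
  have hji : ¬ Disjoint (qSites j) (qSites i) := fun e => hij e.symm
  rw [hcomm, sub_self]
  · by_contra hi
    refine hn ⟨Or.inl hi, Or.inr (Set.mem_biUnion hi hji)⟩
  · by_contra hj
    exact hn ⟨Or.inr (Set.mem_biUnion hj hij), Or.inl hj⟩

/-- The superderivation `δ_Nic(A) = [Q_Nic, A]_γ = ∑_i [q_i, A]_γ` on the local algebra. -/
def delta (A : localAlgebra) : localAlgebra :=
  ⟨∑ᶠ i : ℤ, gradedComm (q i) A, finsum_induction (· ∈ localAlgebra) (zero_mem _)
    (fun _ _ => add_mem) (fun i => gradedComm_mem_local (q_mem_local i) A.2)⟩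

/-- The superderivation `δ_Nic*(A) = [Q_Nic*, A]_γ = ∑_i [q_i*, A]_γ` on the local algebra. -/
def deltaStar (A : localAlgebra) : localAlgebra :=
  ⟨∑ᶠ i : ℤ, gradedComm (star (q i)) A, finsum_induction (· ∈ localAlgebra) (zero_mem _)
    (fun _ _ => add_mem) (fun i => gradedComm_mem_local (star_mem (q_mem_local i)) A.2)⟩

/-- The time generator `d_Nic(A) = [H_Nic, A] = ∑_{i,j} [{q_i, q_j*}, A]` on the local algebra. -/
def d (A : localAlgebra) : localAlgebra :=
  ⟨∑ᶠ p : ℤ × ℤ, (hTerm p.1 p.2 * (A : Op) - (A : Op) * hTerm p.1 p.2),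
    finsum_induction (· ∈ localAlgebra) (zero_mem _) (fun _ _ => add_mem)
      (fun p => sub_mem (mul_mem (hTerm_mem_local p.1 p.2) A.2) (mul_mem A.2 (hTerm_mem_local p.1 p.2)))⟩

/-! ### Time evolution -/

/-- The graph of the (infinitesimal) generator of a family `(α_t)` of automorphisms of `𝒜`:
the pairs `(X, Y)` such that `t ↦ α_t(X)` has derivative `Y` in norm at `t = 0`. -/
def generatorGraph (α : ℝ → (CAR ≃⋆ₐ[ℂ] CAR)) : Set (CAR × CAR) :=
  {p | HasDerivAt (fun t : ℝ => α t p.1) p.2 0}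

/-- `α` is the Nicolai time evolution: a strongly continuous one-parameter group of
`*`-automorphisms of `𝒜` having `d_Nic` on `𝒜_∘` as pre-generator. In the normalization
`α_t(X) = e^{itH} X e^{-itH}` this says that the generator of `α` is the closure of `i d_Nic`. -/
structure IsTimeEvolution (α : ℝ → (CAR ≃⋆ₐ[ℂ] CAR)) : Prop where
  zero : ∀ X, α 0 X = X
  add : ∀ s t X, α (s + t) X = α s (α t X)
  continuous : ∀ X, Continuous fun t => α t X
  preGenerator :
    generatorGraph α = closure (Set.range fun A : localAlgebra => (toCAR A, Complex.I • toCAR (d A)))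

end Nicolai

end

noncomputable section

namespace Nicolai

/-! ### The generator as a composition of superderivations -/

/-! Formally `d = δ ∘ δ* + δ* ∘ δ`. The graded Jacobi identity (`gradedComm_jacobi`) splits each
`[{q_i, q_j*}, B]` into `[q_i, [q_j*, B]_γ]_γ + [q_j*, [q_i, B]_γ]_γ`. For local `B` all sums are
finite, so the sum over the inner index can be moved inside the outer commutator, where it becomes
`δ*(B)` or `δ(B)`. Both vanish, hence `d(B) = 0` (`d_eq_zero`). Thus `B` lies in the domain of the
generator of `α`, with value `0`. The group law carries the vanishing derivative at time `0` to
every time, so the orbit of `B` is constant (`fixed_of_generatorGraph_zero`). -/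

theorem grading_sub (X Y : Op) : grading (X - Y) = grading X - grading Y := by
  simp only [grading, mul_sub, sub_mul]

/-- The graded commutator with a fixed odd element, as an additive map. -/
def oddCommHom {F : Op} (hF : grading F = -F) : Op →+ Op :=
  AddMonoidHom.mk' (gradedComm F) fun X Y => by
    simp only [gradedComm_of_odd hF, grading_add, mul_add, add_mul]
    abel

theorem oddCommHom_apply {F : Op} (hF : grading F = -F) (X : Op) :
    oddCommHom hF X = gradedComm F X := rfl

theorem gradedComm_zero_of_odd {F : Op} (hF : grading F = -F) : gradedComm F 0 = 0 :=
  (oddCommHom hF).map_zero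

/-- The graded Jacobi identity for two odd elements. -/
theorem gradedComm_jacobi {F G : Op} (hF : grading F = -F) (hG : grading G = -G) (X : Op) :
    (F * G + G * F) * X - X * (F * G + G * F) =
      gradedComm F (gradedComm G X) + gradedComm G (gradedComm F X) := by
  -- For odd `F` the bracket is `F X - γ(X) F`, whatever the parity of `X`. The cross terms `F γ(X)
  -- G` and `G γ(X) F` occur once with each sign and cancel.
  simp only [gradedComm_of_odd hF, gradedComm_of_odd hG, grading_sub, grading_mul, hF, hG,
    grading_grading]
  noncomm_ring

/-- A double graded commutator with two locally finite families of odd elements has only finitely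
many nonzero terms. -/
theorem finite_support_gradedComm_comp {u v : ℤ → Op} (hu : ∀ i, grading (u i) = -u i)
    (hv : ∀ i, v i ∈ localAlgebra)
    (hfu : ∀ X ∈ localAlgebra, (Function.support fun i => gradedComm (u i) X).Finite)
    (hfv : ∀ X ∈ localAlgebra, (Function.support fun i => gradedComm (v i) X).Finite)
    {X : Op} (hX : X ∈ localAlgebra) :
    (Function.support fun p : ℤ × ℤ => gradedComm (u p.1) (gradedComm (v p.2) X)).Finite := by
  -- The support lies in a finite box: `j` ranges over the support of the inner bracket, and `i`
  -- over the union of the outer supports for those `j`, each finite because the inner bracket is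
  -- again local.
  refine (((hfv X hX).biUnion fun j _ =>
    hfu _ (gradedComm_mem_local (hv j) hX)).prod (hfv X hX)).subset ?_
  rintro ⟨i, j⟩ hp
  have hj : j ∈ Function.support fun j => gradedComm (v j) X := by
    intro h0
    refine hp ?_
    change gradedComm (u i) (gradedComm (v j) X) = 0
    rw [show gradedComm (v j) X = 0 from h0, gradedComm_zero_of_odd (hu i)]
  exact ⟨Set.mem_biUnion hj hp, hj⟩

/-- If the superderivation of a locally finite odd family annihilates `X`, so does its composition
with another such superderivation. -/
theorem finsum_gradedComm_comp_eq_zero {u v : ℤ → Op} (hu : ∀ i, grading (u i) = -u i)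
    (hv : ∀ i, v i ∈ localAlgebra)
    (hfu : ∀ X ∈ localAlgebra, (Function.support fun i => gradedComm (u i) X).Finite)
    (hfv : ∀ X ∈ localAlgebra, (Function.support fun i => gradedComm (v i) X).Finite)
    {X : Op} (hX : X ∈ localAlgebra) (h0 : ∑ᶠ j, gradedComm (v j) X = 0) :
    ∑ᶠ p : ℤ × ℤ, gradedComm (u p.1) (gradedComm (v p.2) X) = 0 := by
  -- With `i` fixed, the sum over `j` is the bracket of `u i` with the vanishing inner sum.
  rw [finsum_curry _ (finite_support_gradedComm_comp hu hv hfu hfv hX)]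
  refine finsum_eq_zero_of_forall_eq_zero fun i => ?_
  have h := (oddCommHom (hu i)).map_finsum (hfv X hX)
  rw [h0, map_zero] at h
  exact h.symm

/-- This is `d = δ ∘ δ* + δ* ∘ δ` evaluated at `B`, where each composition already vanishes at its
inner map. -/
theorem d_eq_zero {B : localAlgebra} (hB : delta B = 0) (hB' : deltaStar B = 0) : d B = 0 := by
  have h1 : ∑ᶠ i, gradedComm (q i) (B : Op) = 0 := congrArg Subtype.val hB
  have h2 : ∑ᶠ i, gradedComm (star (q i)) (B : Op) = 0 := congrArg Subtype.val hB'
  have hs : ∀ i, star (q i) ∈ localAlgebra := fun i => star_mem (q_mem_local i)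
  have f1 := finite_support_gradedComm_comp grading_q hs (fun _ => finite_support_q)
    (fun _ => finite_support_star_q) B.2
  -- In the second Jacobi term the outer bracket carries the second index of `hTerm`, so the index
  -- pair has to be swapped, here and in `z2`.
  have f2 := (finite_support_gradedComm_comp grading_star_q q_mem_local
    (fun _ => finite_support_star_q) (fun _ => finite_support_q) B.2).preimage
    (Prod.swap_injective (α := ℤ) (β := ℤ)).injOn
  have z1 := finsum_gradedComm_comp_eq_zero grading_q hs (fun _ => finite_support_q)
    (fun _ => finite_support_star_q) B.2 h2
  have z2 := finsum_gradedComm_comp_eq_zero grading_star_q q_mem_local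
    (fun _ => finite_support_star_q) (fun _ => finite_support_q) B.2 h1
  rw [← finsum_comp_equiv (Equiv.prodComm ℤ ℤ)] at z2
  refine Subtype.ext ?_
  change ∑ᶠ p : ℤ × ℤ, (hTerm p.1 p.2 * (B : Op) - (B : Op) * hTerm p.1 p.2) = 0
  simp only [hTerm, gradedComm_jacobi (grading_q _) (grading_star_q _)]
  -- Splitting the sum needs both supports finite, since `finsum` is `0` by default on infinite
  -- support.
  refine (finsum_add_distrib f1 f2).trans ?_
  rw [z1, zero_add]
  exact z2

/-! ### Orbits of the time evolution -/

/-- Closedness makes `CAR` a C*-algebra for instance search; the isometry of its `*`-automorphisms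
depends on this. -/
instance : IsClosed (CAR : Set Op) := StarSubalgebra.isClosed_topologicalClosure localAlgebra

theorem continuous_carAut (φ : CAR ≃⋆ₐ[ℂ] CAR) : Continuous φ :=
  (StarAlgEquiv.isometry φ).continuous

/-- An element annihilated by the generator of a one-parameter group of automorphisms is fixed. -/
theorem fixed_of_generatorGraph_zero {α : ℝ → (CAR ≃⋆ₐ[ℂ] CAR)} (h0 : ∀ X, α 0 X = X)
    (hadd : ∀ s t X, α (s + t) X = α s (α t X)) {X : CAR} (hX : (X, 0) ∈ generatorGraph α) (t : ℝ) :
    α t X = X := by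
  have hd0 : HasDerivAt (fun t : ℝ => α t X) 0 0 := hX
  have hd : ∀ s : ℝ, HasDerivAt (fun t : ℝ => α t X) 0 s := by
    intro s
    -- Time is real, so `α s` is viewed as a real-linear continuous map in order to apply the chain
    -- rule.
    let L : CAR →L[ℝ] CAR :=
      { toFun := α s
        map_add' := map_add (α s)
        map_smul' := fun r Y => map_smul (α s) (r : ℂ) Y
        cont := continuous_carAut (α s) }
    -- Writing `0` as `s - s` fits the translation `t ↦ t - s` in `α_t(X) = α_s(α_{t-s}(X))`.
    have hd0' : HasDerivAt (fun t : ℝ => α t X) 0 (s - s) := by rwa [sub_self]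
    have h := (L.hasFDerivAt.comp_hasDerivAt (s - s) hd0').comp_sub_const s s
    rw [map_zero] at h
    refine h.congr_of_eventuallyEq (Filter.Eventually.of_forall fun t => ?_)
    change α t X = α s (α (t - s) X)
    rw [← hadd, add_sub_cancel]
  have hc := is_const_of_deriv_eq_zero (fun s => (hd s).differentiableAt)
    (fun s => (hd s).deriv) t 0
  simpa only [h0] using hc

end Nicolai

end

theorem proposition2 (α : ℝ → (Nicolai.CAR ≃⋆ₐ[ℂ] Nicolai.CAR))
    (hα : Nicolai.IsTimeEvolution α) (B : Nicolai.localAlgebra)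
    (hB : Nicolai.delta B = 0) (hB' : Nicolai.deltaStar B = 0) :
    ∀ t : ℝ, α t (Nicolai.toCAR B) = Nicolai.toCAR B := by
  refine Nicolai.fixed_of_generatorGraph_zero hα.zero hα.add ?_
  rw [hα.preGenerator]
  -- As `B` is local, `(B, 0) = (B, i d(B))` already lies in the graph before closure.
  refine subset_closure ⟨B, ?_⟩
  simp only [Nicolai.d_eq_zero hB hB', map_zero, smul_zero]
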